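/- Let $A_I\in\mathbb Q^{m\times n_1}$, $A_C\in\mathbb Q^{m\times n_2}$, $b\in\mathbb Q^m$, $E_I\in\mathbb Q^{l\times n_1}$, $E_C\in\mathbb Q^{l\times n_2}$, $f\in\mathbb Q^l$, $c_I\in\mathbb Q^{n_1}$, $c_C\in\mathbb Q^{n_2}$, and consider the mixed-integer linear program $$z_{IP}=\min\{c^\top x:\ Ax=b,\ x\in X\},\qquad X=\{x=(x_I,x_C)\in\mathbb Z^{n_1}\times\mathbb R^{n_2}:\ Ex\le f\},$$ where $c^\top x=c_I^\top x_I+c_C^\top x_C$, $Ax=A_Ix_I+A_Cx_C$ and $Ex=E_Ix_I+E_Cx_C$. Let $X_R$ be the continuous relaxation of $X$ (the condition $x_I\in\mathbb Z^{n_1}$ is replaced by $x_I\in\mathbb R^{n_1}$). Assume that the program is feasible and that $c^\top x$ is bounded below on $\{x\in X_R: Ax=b\}$. For $u\in\mathbb R^m$ let $\phi(u)=\inf\{c^\top x: x\in X,\ Ax=b+u\}\in[-\infty,\infty]$ be the value function, and for $\psi:\mathbb R^m\to\mathbb R$, $\rho\in\mathbb R$, $\lambda\in\mathbb R^m$ put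 $$z^{LR+}_{\rho,\psi}(\lambda)=\inf_{x\in X}\big(c^\top x+\lambda^\top(b-Ax)+\rho\,\psi(b-Ax)\big),\qquad z^{LD+}_{\rho,\psi}=\sup_{\lambda\in\mathbb R^m}z^{LR+}_{\rho,\psi}(\lambda).$$ For a real matrix $M$ and a real vector $v$ indexed by the columns of $M$ let $\Gamma(M,v)=\beta(M)\|v\|$, where $\|v\|$ is the Euclidean norm and $\beta(M)$ is the maximum of the spectral norms $\|B^{-1}\|$ over all invertible square submatrices $B$ of $M$ (the empty submatrix is included and counts as $0$). Then the following hold. (1) (Exact penalty representation.) For every norm $\psi$ on $\mathbb R^m$ there is a finite $\rho>0$ with $z^{LD+}_{\rho,\psi}=\phi(0)$. Moreover there is $\rho^*>0$ such that $z^{LD+}_{\rho,\psi}=z^{LR+}_{\rho,\psi}(0)=\phi(0)$ for all $\rho>\rho^*$. (2) (Local Lipschitz bound near $0$.) There is $\delta>0$ such that $\phi(0)\le\phi(u)+\Gamma\|u\|$ for all $u\in\mathbb R^m$ with $\|u\|\le\delta$, where $$\Gamma=\Gamma\left(\begin{pmatrix}A_C&-A_C&0\\E_C&-E_C&I\end{pmatrix},\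 (c_C,-c_C,0)\right).$$ If the inequalities $Ex\le f$ say exactly that $x\ge 0$, then such a $\delta$ also exists for $\Gamma=\Gamma(A_C,c_C)$, which depends only on $A_C$ and $c_C$. (3) (The penalty parameter.) The minima $z_{IP}=\phi(0)$ and $z_R=\min\{c^\top x: x\in X_R,\ Ax=b\}$ are attained, and the continuous relaxation has a Karush–Kuhn–Tucker point $(x,\lambda_A,\lambda_E)$, that is: $x\in X_R$, $Ax=b$, $\lambda_E\ge0$, $c=A^\top\lambda_A-E^\top\lambda_E$ and $\lambda_E^\top(f-Ex)=0$. For every such point, for all $\kappa\ge0$ and $\delta>0$ with $\phi(0)\le\phi(u)+\kappa\|u\|$ whenever $\|u\|\le\delta$ (in particular for $\kappa=\Gamma$ and $\delta$ as in (2)), and for every $$\rho>\max\Big\{\kappa,\ \|\lambda_A\|+\frac{z_{IP}-z_R}{\delta}\Big\},$$ one has, with $\psi=\|\cdot\|$ the Euclidean norm, $$z^{LD+}_{\rho,\psi}=z^{LR+}_{\rho,\psi}(0)=\min_{x\in X}\big(c^\top x+\rho\|b-Ax\|\big)=z_{IP},$$ and this last minimum is attained. -/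

import Mathlib

open scoped Matrix

noncomputable section

/-- Data of a rational mixed-integer linear program with `n₁` integer and `n₂` continuous
variables, `m` equality constraints (the ones that get penalized) and `l` inequality constraints:
minimize `c_I ⬝ x_I + c_C ⬝ x_C` subject to `A_I x_I + A_C x_C = b`, `E_I x_I + E_C x_C ≤ f`,
`x_I` integer and `x_C` real. -/
structure MILP (m l n₁ n₂ : ℕ) where
  A_I : Matrix (Fin m) (Fin n₁) ℚ
  A_C : Matrix (Fin m) (Fin n₂) ℚ
  b : Fin m → ℚ
  E_I : Matrix (Fin l) (Fin n₁) ℚ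
  E_C : Matrix (Fin l) (Fin n₂) ℚ
  f : Fin l → ℚ
  c_I : Fin n₁ → ℚ
  c_C : Fin n₂ → ℚ

/-- The real matrix with the entries of a given rational matrix. -/
def realMat {p q : Type*} (M : Matrix p q ℚ) : Matrix p q ℝ := M.map (fun a : ℚ => (a : ℝ))

/-- The real vector with the entries of a given rational vector. -/
def realVec {p : Type*} (v : p → ℚ) : p → ℝ := fun i => (v i : ℝ)

/-- The spectral norms of the inverses of all invertible square submatrices of `M`. The empty
submatrix is allowed and contributes the value `0`. -/
def invNorms {p q : Type*} (M : Matrix p q ℝ) : Set ℝ :=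
  {t | ∃ (k : ℕ) (r : Fin k ↪ p) (s : Fin k ↪ q), IsUnit (M.submatrix r s).det ∧
    t = ‖Matrix.toEuclideanCLM (n := Fin k) (𝕜 := ℝ) (M.submatrix r s)⁻¹‖}

/-- `β(M)`: the largest spectral norm of the inverse of an invertible square submatrix of `M`. -/
def invBound {p q : Type*} (M : Matrix p q ℝ) : ℝ := sSup (invNorms M)

theorem invNorms_finite {p q : Type*} [Finite p] [Finite q] (M : Matrix p q ℝ) :
    (invNorms M).Finite := by
  have := Fintype.ofFinite p
  refine Set.Finite.subset (Set.finite_range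
    (fun i : (Σ k : Fin (Fintype.card p + 1), (Fin k ↪ p) × (Fin k ↪ q)) =>
      ‖Matrix.toEuclideanCLM (n := Fin i.1) (𝕜 := ℝ) (M.submatrix i.2.1 i.2.2)⁻¹‖)) ?_
  rintro t ⟨k, r, s, -, rfl⟩
  have hk : k < Fintype.card p + 1 := by
    have := Fintype.card_le_of_embedding r
    simp only [Fintype.card_fin] at this
    omega
  exact ⟨⟨⟨k, hk⟩, r, s⟩, rfl⟩

theorem invNorms_nonempty {p q : Type*} (M : Matrix p q ℝ) : (invNorms M).Nonempty :=
  ⟨_, 0, ⟨Fin.elim0, fun a => a.elim0⟩, ⟨Fin.elim0, fun a => a.elim0⟩, by simp, rfl⟩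

/-- The constant `β(M) ‖c‖` (Euclidean norm of `c`). -/
def lipBound {p q : Type*} [Fintype q] (M : Matrix p q ℝ) (c : q → ℝ) : ℝ :=
  invBound M * ‖WithLp.toLp 2 c‖

namespace MILP

variable {m l n₁ n₂ : ℕ}

/-- The objective `c_I ⬝ x_I + c_C ⬝ x_C`. -/
def obj (P : MILP m l n₁ n₂) (x : (Fin n₁ → ℝ) × (Fin n₂ → ℝ)) : ℝ :=
  realVec P.c_I ⬝ᵥ x.1 + realVec P.c_C ⬝ᵥ x.2

/-- The residual `b - A x` of the equality constraints. -/
def residual (P : MILP m l n₁ n₂) (x : (Fin n₁ → ℝ) × (Fin n₂ → ℝ)) : EuclideanSpace ℝ (Fin m) :=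
  WithLp.toLp 2 (realVec P.b - (realMat P.A_I *ᵥ x.1 + realMat P.A_C *ᵥ x.2))

/-- The continuous relaxation `X_R = {x | E x ≤ f}` of `X`. -/
def XR (P : MILP m l n₁ n₂) : Set ((Fin n₁ → ℝ) × (Fin n₂ → ℝ)) :=
  {x | realMat P.E_I *ᵥ x.1 + realMat P.E_C *ᵥ x.2 ≤ realVec P.f}

/-- The mixed-integer set `X`. -/
def X (P : MILP m l n₁ n₂) : Set ((Fin n₁ → ℝ) × (Fin n₂ → ℝ)) :=
  {x | x ∈ P.XR ∧ ∀ i, ∃ z : ℤ, x.1 i = z}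

/-- The affine subspace `H_u = {x | A x = b + u}`. -/
def H (P : MILP m l n₁ n₂) (u : EuclideanSpace ℝ (Fin m)) : Set ((Fin n₁ → ℝ) × (Fin n₂ → ℝ)) :=
  {x | ∀ i, (realMat P.A_I *ᵥ x.1 + realMat P.A_C *ᵥ x.2) i = realVec P.b i + u i}

/-- The value function `φ(u) = inf {c x | x ∈ X ∩ H_u}`, with value `⊤` if `X ∩ H_u` is empty. -/
def value (P : MILP m l n₁ n₂) (u : EuclideanSpace ℝ (Fin m)) : EReal :=
  ⨅ x ∈ P.X ∩ P.H u, (P.obj x : EReal)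

/-- The augmented Lagrangian relaxation
`inf {c x + λ ⬝ (b - A x) + ρ ψ(b - A x) | x ∈ X}`. -/
def augRelax (P : MILP m l n₁ n₂) (ψ : EuclideanSpace ℝ (Fin m) → ℝ) (ρ : ℝ)
    (lam : EuclideanSpace ℝ (Fin m)) : EReal :=
  ⨅ x ∈ P.X, ((P.obj x + inner ℝ lam (P.residual x) + ρ * ψ (P.residual x) : ℝ) : EReal)

/-- The augmented Lagrangian dual, the supremum over `λ` of the augmented Lagrangian relaxation. -/
def augDual (P : MILP m l n₁ n₂) (ψ : EuclideanSpace ℝ (Fin m) → ℝ) (ρ : ℝ) : EReal :=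
  ⨆ lam : EuclideanSpace ℝ (Fin m), P.augRelax ψ ρ lam

/-- `ψ` gives an exact penalty representation: some finite `ρ > 0` closes the duality gap. -/
def HasExactPenalty (P : MILP m l n₁ n₂) (ψ : EuclideanSpace ℝ (Fin m) → ℝ) : Prop :=
  ∃ ρ : ℝ, 0 < ρ ∧ P.augDual ψ ρ = P.value 0

/-- The bound `φ(0) ≤ φ(u) + κ ‖u‖` for all `u` in the closed Euclidean `δ`-ball around `0`. -/
def LocalBound (P : MILP m l n₁ n₂) (κ δ : ℝ) : Prop :=
  ∀ u : EuclideanSpace ℝ (Fin m), ‖u‖ ≤ δ → P.value 0 ≤ P.value u + ((κ * ‖u‖ : ℝ) : EReal)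

/-- The continuous columns of the equality form of the program, obtained by splitting
`x_C = x_C⁺ - x_C⁻` and adding a slack variable to every inequality. -/
def stdMatrix (P : MILP m l n₁ n₂) :
    Matrix (Fin m ⊕ Fin l) ((Fin n₂ ⊕ Fin n₂) ⊕ Fin l) ℝ :=
  Matrix.fromBlocks
    (Matrix.fromCols (realMat P.A_C) (-realMat P.A_C)) 0
    (Matrix.fromCols (realMat P.E_C) (-realMat P.E_C)) 1

/-- The costs `(c_C, -c_C, 0)` of the continuous variables of the equality form. -/
def stdCost (P : MILP m l n₁ n₂) : (Fin n₂ ⊕ Fin n₂) ⊕ Fin l → ℝ :=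
  Sum.elim (Sum.elim (realVec P.c_C) (-realVec P.c_C)) 0

/-- The inequality constraints of `P` say exactly that all variables are nonnegative. -/
def IsNonnegForm (P : MILP m l n₁ n₂) : Prop :=
  P.XR = {x | 0 ≤ x.1 ∧ 0 ≤ x.2}

/-- `x` is a Karush-Kuhn-Tucker point of the continuous relaxation, with Lagrange multipliers
`lamA` for `A x = b` and `lamE` for `E x ≤ f`. -/
structure IsKKT (P : MILP m l n₁ n₂) (x : (Fin n₁ → ℝ) × (Fin n₂ → ℝ))
    (lamA : EuclideanSpace ℝ (Fin m)) (lamE : Fin l → ℝ) : Prop where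
  feasible : x ∈ P.XR ∩ P.H 0
  nonneg : 0 ≤ lamE
  stationary_I : realVec P.c_I = (realMat P.A_I)ᵀ *ᵥ lamA.ofLp - (realMat P.E_I)ᵀ *ᵥ lamE
  stationary_C : realVec P.c_C = (realMat P.A_C)ᵀ *ᵥ lamA.ofLp - (realMat P.E_C)ᵀ *ᵥ lamE
  complementary :
    lamE ⬝ᵥ (realVec P.f - (realMat P.E_I *ᵥ x.1 + realMat P.E_C *ᵥ x.2)) = 0

end MILP

end

/-!
The whole argument rests on one fact about linear programs `min {c ⬝ w | M w = d, w ≥ 0}` with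
rational `M`, `c` and a varying real right-hand side `d`. The epigraph `{(d, t)}` of the value
function is the cone generated by the columns `(M_j, c_j)` and `(0, 1)`, so it is cut out by finitely
many *rational* inequalities (`exists_finset_cone_iff`, by Fourier-Motzkin elimination). Hence there
are finitely many rational vectors `h` that decide feasibility (`h ⬝ d ≥ 0`), and finitely many
rational dual vectors `y` whose maximum `y ⬝ d` is the value (`exists_lp_certificates`). This contains
Farkas' lemma, strong duality and the attainment of the optimum.

The equality form of the mixed-integer program has, for every integer vector `z`, a right-hand side
`g - N z` of this kind.
* The numbers `y ⬝ (g - N z)` have a common denominator, so the values of the programs with fixed `z`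
  lie in a lattice and a finite infimum over `z` is attained (`exists_mixedInteger_minimum`).
* The numbers `h ⬝ (g - N z)` also have a common denominator. If `z` is feasible after a
  sufficiently small perturbation of the right-hand side, then these numbers are larger than minus
  one lattice step, hence nonnegative: `z` is feasible without the perturbation. It remains to
  compare the two linear programs with the same `z`. By weak duality their values differ by at most
  `‖y‖ ‖u‖` for an optimal dual `y` of the unperturbed program, and `y` can be chosen basic, that is,
  `y = B⁻ᵀ c_B` for an invertible square submatrix `B` of `M`, so that `‖y‖ ≤ β(M) ‖c‖`
  (`exists_dual_norm_le`, `exists_perturbation_bound`). Applied to the equality form and, for programs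
  in nonnegative variables, to `A_C` itself, this is the local Lipschitz bound.

For the penalty let `x ∈ X` and `u = A x - b`. If `‖u‖ ≤ δ`, the local bound gives
`z_IP ≤ c x + κ ‖u‖`; if `‖u‖ > δ`, then the multipliers of the continuous relaxation give
`c x ≥ z_R - ‖λ_A‖ ‖u‖`, and the penalty makes up for the gap `z_IP - z_R`
(`MILP.IsKKT.le_obj_add_penalty`). Other norms are compared with the Euclidean norm.
-/

/-! ### Fourier-Motzkin elimination and certificates for linear programs -/

theorem realVec_dotProduct {p : Type*} [Fintype p] (h v : p → ℚ) :
    realVec h ⬝ᵥ realVec v = ((h ⬝ᵥ v : ℚ) : ℝ) := by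
  simp [realVec, dotProduct]

theorem realVec_sub {p : Type*} (a b : p → ℚ) : realVec (a - b) = realVec a - realVec b := by
  ext; simp [realVec]

theorem realVec_smul {p : Type*} (a : ℚ) (b : p → ℚ) :
    realVec (a • b) = (a : ℝ) • realVec b := by
  ext; simp [realVec]

theorem realMat_mulVec_eq_sum {p q : Type*} [Fintype q] (M : Matrix p q ℚ) (w : q → ℝ) :
    realMat M *ᵥ w = ∑ j, w j • realVec (Mᵀ j) := by
  ext i
  simp [Matrix.mulVec, dotProduct, realMat, realVec, mul_comm]

/-- Weyl's theorem for rational generators: the real cone generated by finitely many rational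
vectors is cut out by finitely many rational linear inequalities. The proof adds one generator at a
time and eliminates its coefficient by Fourier-Motzkin. -/
theorem exists_finset_cone_iff {p q : Type*} [Fintype p] (v : q → p → ℚ) (s : Finset q) :
    ∃ H : Finset (p → ℚ), ∀ x : p → ℝ,
      (∃ w : q → ℝ, 0 ≤ w ∧ ∑ j ∈ s, w j • realVec (v j) = x) ↔
        ∀ h ∈ H, 0 ≤ realVec h ⬝ᵥ x := by
  classical
  induction s using Finset.induction_on with
  | empty =>
    -- the cone `{0}` is given by the inequalities `x i ≥ 0` and `-x i ≥ 0`
    refine ⟨Finset.univ.image (fun i => Pi.single i 1) ∪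
      Finset.univ.image (fun i => Pi.single i (-1)), fun x => ?_⟩
    have key : ∀ i (a : ℚ), realVec (Pi.single i a) ⬝ᵥ x = a * x i := by
      intro i a
      have : realVec (Pi.single i a) = Pi.single i (a : ℝ) := by
        ext k
        by_cases hk : k = i
        · subst hk; simp [realVec]
        · simp [realVec, hk]
      rw [this, single_dotProduct]
    constructor
    · rintro ⟨w, -, rfl⟩ h -
      simp
    · intro hx
      refine ⟨0, le_rfl, ?_⟩
      ext i
      have h1 := hx (Pi.single i 1) (by simp)
      have h2 := hx (Pi.single i (-1)) (by simp)
      rw [key] at h1 h2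
      push_cast at h1 h2
      simp only [Finset.sum_empty, Pi.zero_apply]
      linarith
  | insert a s ha ih =>
    obtain ⟨H, hH⟩ := ih
    refine ⟨H.filter (fun h => 0 ≤ h ⬝ᵥ v a) ∪
      ((H.filter (fun h => h ⬝ᵥ v a < 0)) ×ˢ (H.filter (fun h => 0 < h ⬝ᵥ v a))).image
        (fun g => (g.2 ⬝ᵥ v a) • g.1 - (g.1 ⬝ᵥ v a) • g.2), fun x => ?_⟩
    -- the coefficient `τ` of the new generator is the variable to eliminate
    have hstep : (∃ w : q → ℝ, 0 ≤ w ∧ ∑ j ∈ insert a s, w j • realVec (v j) = x) ↔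
        ∃ τ : ℝ, 0 ≤ τ ∧ ∀ h ∈ H, τ * ((h ⬝ᵥ v a : ℚ) : ℝ) ≤ realVec h ⬝ᵥ x := by
      constructor
      · rintro ⟨w, hw, hx⟩
        refine ⟨w a, hw a, fun h hh => ?_⟩
        rw [Finset.sum_insert ha] at hx
        have := (hH (x - w a • realVec (v a))).1 ⟨w, hw, by rw [← hx]; simp⟩ h hh
        rw [dotProduct_sub, dotProduct_smul, realVec_dotProduct, smul_eq_mul] at this
        linarith
      · rintro ⟨τ, hτ, h⟩
        obtain ⟨w, hw, hx⟩ := (hH (x - τ • realVec (v a))).2 (fun g hg => by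
          rw [dotProduct_sub, dotProduct_smul, realVec_dotProduct, smul_eq_mul]
          linarith [h g hg])
        refine ⟨Function.update w a τ, fun j => ?_, ?_⟩
        · by_cases hj : j = a
          · subst hj; simpa using hτ
          · simpa [hj] using hw j
        · rw [Finset.sum_insert ha, Finset.sum_congr rfl (g := fun j => w j • realVec (v j)), hx]
          · simp
          · intro j hj
            rw [Function.update_of_ne (by rintro rfl; exact ha hj)]
    rw [hstep]
    simp only [Finset.mem_union, Finset.mem_filter, Finset.mem_image, Finset.mem_product]
    constructor
    · rintro ⟨τ, hτ, h⟩ g (⟨hg, hgv⟩ | ⟨⟨g₁, g₂⟩, ⟨⟨hg₁, hn⟩, ⟨hg₂, hp⟩⟩, rfl⟩)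
      · exact (mul_nonneg hτ (by exact_mod_cast hgv)).trans (h g hg)
      · simp only at hn hp ⊢
        have hn' : ((g₁ ⬝ᵥ v a : ℚ) : ℝ) < 0 := by exact_mod_cast hn
        have hp' : (0 : ℝ) < ((g₂ ⬝ᵥ v a : ℚ) : ℝ) := by exact_mod_cast hp
        rw [realVec_sub, realVec_smul, realVec_smul, sub_dotProduct, smul_dotProduct,
          smul_dotProduct, smul_eq_mul, smul_eq_mul]
        nlinarith [mul_le_mul_of_nonneg_left (h g₁ hg₁) hp'.le,
          mul_le_mul_of_nonneg_left (h g₂ hg₂) (neg_pos.2 hn').le]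
    · intro hx
      -- `τ` is the largest of the lower bounds `0` and `h x / h v` with `h v < 0`
      let S : Finset ℝ := insert 0 ((H.filter (fun h => h ⬝ᵥ v a < 0)).image
        (fun h => (realVec h ⬝ᵥ x) / ((h ⬝ᵥ v a : ℚ) : ℝ)))
      have hS : S.Nonempty := ⟨0, by simp [S]⟩
      refine ⟨S.max' hS, S.le_max' _ (by simp [S]), fun h hh => ?_⟩
      rcases lt_trichotomy (h ⬝ᵥ v a) 0 with hn | h0 | hp
      · have hn' : ((h ⬝ᵥ v a : ℚ) : ℝ) < 0 := by exact_mod_cast hn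
        rw [← div_le_iff_of_neg hn']
        refine S.le_max' _ (Finset.mem_insert_of_mem ?_)
        exact Finset.mem_image_of_mem _ (Finset.mem_filter.2 ⟨hh, hn⟩)
      · simpa [h0] using hx h (Or.inl ⟨hh, h0.ge⟩)
      · have hp' : (0 : ℝ) < ((h ⬝ᵥ v a : ℚ) : ℝ) := by exact_mod_cast hp
        rw [← le_div_iff₀ hp']
        refine S.max'_le hS _ fun y hy => ?_
        rcases Finset.mem_insert.1 hy with rfl | hy
        · exact div_nonneg (hx h (Or.inl ⟨hh, hp.le⟩)) hp'.le
        · obtain ⟨g, hg, rfl⟩ := Finset.mem_image.1 hy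
          obtain ⟨hg, hn⟩ := Finset.mem_filter.1 hg
          have hn' : ((g ⬝ᵥ v a : ℚ) : ℝ) < 0 := by exact_mod_cast hn
          have := hx _ (Or.inr ⟨(g, h), ⟨⟨hg, hn⟩, ⟨hh, hp⟩⟩, rfl⟩)
          rw [realVec_sub, realVec_smul, realVec_smul, sub_dotProduct, smul_dotProduct,
            smul_dotProduct, smul_eq_mul, smul_eq_mul] at this
          rw [div_le_iff_of_neg hn', div_mul_eq_mul_div, div_le_iff₀ hp']
          linarith

/-- The feasible set and the epigraph of the value function of a standard form linear program
`min {c ⬝ w | M w = d, w ≥ 0}` with rational `M` and `c`, as the right-hand side `d` varies: the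
value at a feasible `d` is the maximum of `y ⬝ d` over finitely many rational dual vectors `y`. -/
theorem exists_finset_lp_value_iff {p q : Type*} [Fintype p] [Fintype q] (M : Matrix p q ℚ)
    (c : q → ℚ) : ∃ F Y : Finset (p → ℚ), ∀ (d : p → ℝ) (t : ℝ),
      (∃ w : q → ℝ, 0 ≤ w ∧ realMat M *ᵥ w = d ∧ realVec c ⬝ᵥ w ≤ t) ↔
        (∀ h ∈ F, 0 ≤ realVec h ⬝ᵥ d) ∧ ∀ y ∈ Y, realVec y ⬝ᵥ d ≤ t := by
  classical
  -- the epigraph is the cone generated by the columns `(M_j, c_j)` and the vector `(0, 1)`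
  obtain ⟨H, hH⟩ := exists_finset_cone_iff (p := p ⊕ Unit) (q := q ⊕ Unit)
    (Sum.elim (fun j => Sum.elim (Mᵀ j) (fun _ => c j))
      (fun _ => Sum.elim (0 : p → ℚ) (fun _ => 1))) Finset.univ
  have hcone : ∀ (d : p → ℝ) (t : ℝ),
      (∃ w : q → ℝ, 0 ≤ w ∧ realMat M *ᵥ w = d ∧ realVec c ⬝ᵥ w ≤ t) ↔
        ∀ h ∈ H, 0 ≤ realVec h ⬝ᵥ (Sum.elim d (fun _ => t)) := by
    intro d t
    rw [← hH]
    constructor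
    · rintro ⟨w, hw, hd, ht⟩
      refine ⟨Sum.elim w (fun _ => t - realVec c ⬝ᵥ w), ?_, ?_⟩
      · rintro (j | j)
        · exact hw j
        · simpa using ht
      · rw [← hd, realMat_mulVec_eq_sum]
        ext (i | i)
        · simp [realVec]
        · simp [realVec, dotProduct, mul_comm]
    · rintro ⟨w, hw, hx⟩
      refine ⟨fun j => w (Sum.inl j), fun j => hw _, ?_, ?_⟩
      · rw [realMat_mulVec_eq_sum]
        ext i
        have := congrFun hx (Sum.inl i)
        simpa [realVec] using this
      · have h := congrFun hx (Sum.inr ())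
        have h0 : 0 ≤ w (Sum.inr ()) := hw (Sum.inr ())
        simp only [Fintype.sum_sum_type, realVec, Finset.sum_apply, Pi.smul_apply,
          Sum.elim_inl, Sum.elim_inr, smul_eq_mul, Finset.univ_unique, Finset.sum_singleton,
          Rat.cast_one, mul_one] at h
        simp only [realVec, dotProduct, mul_comm (Rat.cast (c _) : ℝ)]
        have h0' : 0 ≤ w (Sum.inr default) := h0
        linarith
  have hsplit : ∀ (h : p ⊕ Unit → ℚ) (d : p → ℝ) (t : ℝ),
      realVec h ⬝ᵥ (Sum.elim d (fun _ => t)) =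
        realVec (fun i => h (Sum.inl i)) ⬝ᵥ d + (h (Sum.inr ()) : ℝ) * t := by
    intro h d t
    simp [realVec, dotProduct]
  have hlast : ∀ h ∈ H, 0 ≤ h (Sum.inr ()) := by
    intro h hh
    have := (hcone 0 1).1 ⟨0, le_rfl, by simp, by simp⟩ h hh
    rw [hsplit] at this
    simpa using this
  refine ⟨(H.filter (fun h => h (Sum.inr ()) = 0)).image (fun h i => h (Sum.inl i)),
    (H.filter (fun h => 0 < h (Sum.inr ()))).image
      (fun h => (-(h (Sum.inr ()))⁻¹) • fun i => h (Sum.inl i)), fun d t => ?_⟩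
  rw [hcone]
  have hpos : ∀ h : p ⊕ Unit → ℚ, 0 < h (Sum.inr ()) →
      (0 ≤ realVec h ⬝ᵥ (Sum.elim d (fun _ => t)) ↔
        realVec ((-(h (Sum.inr ()))⁻¹) • fun i => h (Sum.inl i)) ⬝ᵥ d ≤ t) := by
    intro h hp
    have hp' : (0 : ℝ) < (h (Sum.inr ()) : ℝ) := by exact_mod_cast hp
    rw [hsplit, realVec_smul, smul_dotProduct, smul_eq_mul]
    push_cast
    rw [neg_mul, neg_le, inv_mul_eq_div, le_div_iff₀ hp']
    constructor <;> intro <;> linarith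
  constructor
  · intro h
    refine ⟨fun g hg => ?_, fun y hy => ?_⟩
    · obtain ⟨g, hg', rfl⟩ := Finset.mem_image.1 hg
      obtain ⟨hg, h0⟩ := Finset.mem_filter.1 hg'
      have := h g hg
      rw [hsplit, h0] at this
      simpa using this
    · obtain ⟨g, hg, rfl⟩ := Finset.mem_image.1 hy
      obtain ⟨hg, h0⟩ := Finset.mem_filter.1 hg
      exact (hpos g h0).1 (h g hg)
  · rintro ⟨hF, hY⟩ h hh
    rcases (hlast h hh).eq_or_lt with h0 | hp
    · rw [hsplit, ← h0]
      simpa using hF _ (Finset.mem_image_of_mem _ (Finset.mem_filter.2 ⟨hh, h0.symm⟩))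
    · exact (hpos h hp).2 (hY _ (Finset.mem_image_of_mem _ (Finset.mem_filter.2 ⟨hh, hp⟩)))

/-- Finitely many rational certificates for a rational standard form linear program: `F` decides
feasibility of every right-hand side, `Y` consists of dual feasible vectors, and one of them is
optimal whenever the program is feasible and bounded below; the primal optimum is then attained. -/
theorem exists_lp_certificates {p q : Type*} [Fintype p] [Fintype q] (M : Matrix p q ℚ)
    (c : q → ℚ) : ∃ F Y : Finset (p → ℚ),
      (∀ d : p → ℝ, (∃ w : q → ℝ, 0 ≤ w ∧ realMat M *ᵥ w = d) ↔
        ∀ h ∈ F, 0 ≤ realVec h ⬝ᵥ d) ∧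
      (∀ y ∈ Y, realVec y ᵥ* realMat M ≤ realVec c) ∧
      ∀ (d : p → ℝ) (L : ℝ), (∃ w : q → ℝ, 0 ≤ w ∧ realMat M *ᵥ w = d) →
        (∀ w : q → ℝ, 0 ≤ w → realMat M *ᵥ w = d → L ≤ realVec c ⬝ᵥ w) →
        ∃ w : q → ℝ, 0 ≤ w ∧ realMat M *ᵥ w = d ∧
          ∃ y ∈ Y, realVec c ⬝ᵥ w = realVec y ⬝ᵥ d := by
  classical
  obtain ⟨F, Y, h⟩ := exists_finset_lp_value_iff M c
  have hweak : ∀ y ∈ Y, ∀ w : q → ℝ, 0 ≤ w →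
      realVec y ⬝ᵥ (realMat M *ᵥ w) ≤ realVec c ⬝ᵥ w := fun y hy w hw =>
    ((h _ _).1 ⟨w, hw, rfl, le_rfl⟩).2 y hy
  refine ⟨F, Y, fun d => ⟨?_, fun hF => ?_⟩, fun y hy j => ?_, ?_⟩
  · rintro ⟨w, hw, hd⟩
    exact ((h d _).1 ⟨w, hw, hd, le_rfl⟩).1
  · obtain ⟨t, ht⟩ := (Y.image (fun y => realVec y ⬝ᵥ d)).exists_le
    obtain ⟨w, hw, hd, -⟩ := (h d t).2 ⟨hF, fun y hy => ht _ (Finset.mem_image_of_mem _ hy)⟩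
    exact ⟨w, hw, hd⟩
  · have := hweak y hy (Pi.single j 1) (Pi.single_nonneg.2 zero_le_one)
    rwa [Matrix.dotProduct_mulVec, dotProduct_single_one, dotProduct_single_one] at this
  · rintro d L ⟨w₀, hw₀, hd₀⟩ hL
    have hF := ((h d _).1 ⟨w₀, hw₀, hd₀, le_rfl⟩).1
    have hY : Y.Nonempty := by
      by_contra hne
      rw [Finset.not_nonempty_iff_eq_empty] at hne
      obtain ⟨w, hw, hd, ht⟩ := (h d (L - 1)).2 ⟨hF, by simp [hne]⟩
      linarith [hL w hw hd]
    obtain ⟨y, hy, hmax⟩ := Y.exists_max_image (fun y => realVec y ⬝ᵥ d) hY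
    obtain ⟨w, hw, hd, ht⟩ := (h d (realVec y ⬝ᵥ d)).2 ⟨hF, hmax⟩
    exact ⟨w, hw, hd, y, hy, le_antisymm ht (hd ▸ hweak y hy w hw)⟩

/-! ### Basic optimal dual vectors -/

/-- Moving along a dual direction that is constant on the tight columns until another constraint
becomes tight, one reaches a dual optimal vector whose tight columns span all columns. -/
theorem exists_dual_span_tight {p q : Type*} [Fintype p] [Fintype q] (M : Matrix p q ℝ)
    (c w : q → ℝ) (y : p → ℝ) (hy : y ᵥ* M ≤ c) (hw : ∀ j, w j ≠ 0 → (y ᵥ* M) j = c j) :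
    ∃ y' : p → ℝ, y' ᵥ* M ≤ c ∧ (∀ j, w j ≠ 0 → (y' ᵥ* M) j = c j) ∧
      ∀ j, Mᵀ j ∈ Submodule.span ℝ (Mᵀ '' {i | (y' ᵥ* M) i = c i}) := by
  classical
  let T : (p → ℝ) → Set q := fun y => {i | (y ᵥ* M) i = c i}
  let S : Set (Set q) := T '' {y | y ᵥ* M ≤ c ∧ ∀ j, w j ≠ 0 → (y ᵥ* M) j = c j}
  obtain ⟨t, ⟨y', ⟨hy', hw'⟩, rfl⟩, hmax⟩ :=
    (Set.toFinite S).exists_maximal ⟨_, Set.mem_image_of_mem T ⟨hy, hw⟩⟩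
  refine ⟨y', hy', hw', fun j => ?_⟩
  by_contra hj
  obtain ⟨f, hfj, hf⟩ := Submodule.exists_le_ker_of_notMem hj
  -- represent `f` as `z ⬝ᵥ ·`, with the sign for which it increases on the column `j`
  obtain ⟨z, hz⟩ : ∃ z : p → ℝ, ∀ v, f v = z ⬝ᵥ v := by
    refine ⟨fun i => f (Pi.single i 1), fun v => ?_⟩
    rw [LinearMap.pi_apply_eq_sum_univ f v]
    simp only [dotProduct, smul_eq_mul, mul_comm]
    refine Finset.sum_congr rfl fun i _ => ?_
    congr 2
    ext k
    simp [Pi.single_apply, eq_comm]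
  have hcol : ∀ (a : p → ℝ) i, (a ᵥ* M) i = a ⬝ᵥ Mᵀ i := fun a i => rfl
  obtain ⟨z, hzT, hzj⟩ : ∃ z : p → ℝ, (∀ i ∈ T y', (z ᵥ* M) i = 0) ∧ 0 < (z ᵥ* M) j := by
    have h0 : ∀ i ∈ T y', (z ᵥ* M) i = 0 := fun i hi => by
      rw [hcol, ← hz]
      exact hf (Submodule.subset_span (Set.mem_image_of_mem _ hi))
    rw [hz, ← hcol] at hfj
    rcases lt_or_gt_of_ne hfj with hneg | hpos
    · exact ⟨-z, fun i hi => by simp [Matrix.neg_vecMul, h0 i hi],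
        by simpa [Matrix.neg_vecMul] using hneg⟩
    · exact ⟨z, h0, hpos⟩
  -- the step length is given by the ratio test
  obtain ⟨i, hi, hmin⟩ := (Finset.univ.filter (fun i => 0 < (z ᵥ* M) i)).exists_min_image
    (fun i => (c i - (y' ᵥ* M) i) / (z ᵥ* M) i) ⟨j, by simpa using hzj⟩
  have hzi : 0 < (z ᵥ* M) i := by simpa using hi
  set ε := (c i - (y' ᵥ* M) i) / (z ᵥ* M) i with hε
  have hε0 : 0 ≤ ε := div_nonneg (sub_nonneg.2 (hy' i)) hzi.le
  have hval : ∀ k, ((y' + ε • z) ᵥ* M) k = (y' ᵥ* M) k + ε * (z ᵥ* M) k := fun k => by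
    simp [Matrix.add_vecMul, Matrix.smul_vecMul]
  have hsub : T y' ⊆ T (y' + ε • z) := fun k hk => by
    change ((y' + ε • z) ᵥ* M) k = c k
    rw [hval, hzT k hk, mul_zero, add_zero]
    exact hk
  have hmem : T (y' + ε • z) ∈ S := by
    refine Set.mem_image_of_mem T ⟨fun k => ?_, fun k hk => hsub (hw' k hk)⟩
    rw [hval]
    rcases le_or_gt ((z ᵥ* M) k) 0 with hk | hk
    · nlinarith [hy' k, mul_nonneg hε0 (neg_nonneg.2 hk)]
    · have := hmin k (by simpa using hk)
      rw [le_div_iff₀ hk] at this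
      linarith
  have hiT : i ∈ T (y' + ε • z) := by
    change ((y' + ε • z) ᵥ* M) i = c i
    rw [hval, hε, div_mul_cancel₀ _ hzi.ne']
    ring
  exact hzi.ne' (hzT i (hmax hmem hsub hiT))

/-- Among the columns in `T` and all rows there is an invertible square submatrix whose columns
span the columns in `T`. -/
theorem exists_isUnit_submatrix_span {p q : Type*} [Fintype p] [Fintype q] (M : Matrix p q ℝ)
    (T : Set q) : ∃ (k : ℕ) (r : Fin k ↪ p) (s : Fin k ↪ q), IsUnit (M.submatrix r s).det ∧
      (∀ i, s i ∈ T) ∧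
      Submodule.span ℝ (Set.range (fun i => Mᵀ (s i))) = Submodule.span ℝ (Mᵀ '' T) := by
  classical
  obtain ⟨g, hg, hspan, hli⟩ := Submodule.exists_fun_fin_finrank_span_eq ℝ (Mᵀ '' T)
  generalize Module.finrank ℝ (Submodule.span ℝ (Mᵀ '' T)) = k at g hg hspan hli
  choose s hsT hs using hg
  have hgs : (fun i => Mᵀ (s i)) = g := funext hs
  have hsinj : Function.Injective s := fun a b hab => hli.injective (by rw [← hs a, ← hs b, hab])
  -- the chosen columns form a matrix of rank `k`, so its rows contain a basis of `ℝ^k`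
  set N : Matrix p (Fin k) ℝ := M.submatrix id s with hN
  have hrank : Module.finrank ℝ (Submodule.span ℝ (Set.range N.row)) = k := by
    rw [← Matrix.rank_eq_finrank_span_row]
    have h1 : LinearIndependent ℝ Nᵀ.row := by
      have : Nᵀ.row = g := by
        rw [← hgs]
        rfl
      rw [this]
      exact hli
    have := h1.rank_matrix
    rw [Matrix.rank_transpose] at this
    simpa using this
  have hrows := Submodule.exists_fun_fin_finrank_span_eq ℝ (Set.range N.row)
  rw [hrank] at hrows
  obtain ⟨g', hg', -, hli'⟩ := hrows
  choose r hr using hg'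
  have hrinj : Function.Injective r := fun a b hab =>
    hli'.injective (by rw [← hr a, ← hr b, hab])
  refine ⟨k, ⟨r, hrinj⟩, ⟨s, hsinj⟩, ?_, hsT, ?_⟩
  · rw [← Matrix.isUnit_iff_isUnit_det, ← Matrix.linearIndependent_rows_iff_isUnit]
    have : (M.submatrix r s).row = g' := funext hr
    exact this ▸ hli'
  · change Submodule.span ℝ (Set.range (fun i => Mᵀ (s i))) = _
    rw [hgs, hspan]

/-- The dual vector that is supported on the rows `r` and tight on the columns `s` of an invertible
square submatrix of `M` has norm at most `β(M) ‖c‖`. -/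
theorem exists_basic_dual {p q : Type*} [Fintype p] [Fintype q] (M : Matrix p q ℝ) (c : q → ℝ)
    {k : ℕ} (r : Fin k ↪ p) (s : Fin k ↪ q) (hB : IsUnit (M.submatrix r s).det) :
    ∃ y : p → ℝ, (∀ i, (y ᵥ* M) (s i) = c (s i)) ∧ ‖WithLp.toLp 2 y‖ ≤ lipBound M c := by
  classical
  set B := M.submatrix r s with hBdef
  set a : Fin k → ℝ := (fun i => c (s i)) ᵥ* B⁻¹ with ha
  have haB : a ᵥ* B = fun i => c (s i) := by
    rw [ha, Matrix.vecMul_vecMul, Matrix.nonsing_inv_mul _ hB, Matrix.vecMul_one]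
  have hsum : ∀ g : p → ℝ → ℝ, (∀ i, g i 0 = 0) →
      ∑ i, g i (Function.extend r a 0 i) = ∑ i, g (r i) (a i) := by
    intro g hg
    rw [← Finset.sum_subset (Finset.subset_univ (Finset.univ.map r)), Finset.sum_map]
    · exact Finset.sum_congr rfl fun i _ => by rw [r.injective.extend_apply]
    · intro i _ hi
      rw [Function.extend_apply', Pi.zero_apply, hg]
      rintro ⟨j, rfl⟩
      exact hi (by simp)
  refine ⟨Function.extend r a 0, fun i => ?_, ?_⟩
  · rw [← congrFun haB i]
    exact hsum (fun j t => t * M j (s i)) (by simp)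
  · have h1 : ‖WithLp.toLp 2 (Function.extend r a 0)‖ = ‖WithLp.toLp 2 a‖ := by
      rw [EuclideanSpace.norm_eq, EuclideanSpace.norm_eq]
      congr 1
      exact hsum (fun _ t => ‖t‖ ^ 2) (by simp)
    have h2 : ‖WithLp.toLp 2 (fun i => c (s i))‖ ≤ ‖WithLp.toLp 2 c‖ := by
      rw [EuclideanSpace.norm_eq, EuclideanSpace.norm_eq]
      refine Real.sqrt_le_sqrt ?_
      calc ∑ i, ‖c (s i)‖ ^ 2 = ∑ j ∈ Finset.univ.map s, ‖c j‖ ^ 2 := by rw [Finset.sum_map]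
        _ ≤ ∑ j, ‖c j‖ ^ 2 :=
          Finset.sum_le_sum_of_subset_of_nonneg (Finset.subset_univ _) fun _ _ _ => by positivity
    have h3 : WithLp.toLp 2 a =
        Matrix.toEuclideanCLM (n := Fin k) (𝕜 := ℝ) (star B⁻¹) (WithLp.toLp 2 fun i => c (s i)) := by
      rw [Matrix.toEuclideanCLM_toLp, ha, Matrix.star_eq_conjTranspose,
        Matrix.conjTranspose_eq_transpose_of_trivial, Matrix.mulVec_transpose]
    have h4 : ‖Matrix.toEuclideanCLM (n := Fin k) (𝕜 := ℝ) (star B⁻¹)‖ ≤ invBound M := by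
      rw [map_star, ContinuousLinearMap.star_eq_adjoint, LinearIsometryEquiv.norm_map]
      exact le_csSup (invNorms_finite M).bddAbove ⟨k, r, s, hB, rfl⟩
    rw [h1, h3, lipBound]
    refine (ContinuousLinearMap.le_opNorm _ _).trans ?_
    exact mul_le_mul h4 h2 (norm_nonneg _) ((norm_nonneg _).trans h4)

/-- A dual optimal vector can be replaced by one of norm at most `β(M) ‖c‖`. -/
theorem exists_dual_norm_le {p q : Type*} [Fintype p] [Fintype q] (M : Matrix p q ℝ)
    (c w : q → ℝ) (y : p → ℝ) (hw : 0 ≤ w) (hy : y ᵥ* M ≤ c) (hopt : c ⬝ᵥ w = y ⬝ᵥ (M *ᵥ w)) :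
    ∃ y' : p → ℝ, y' ᵥ* M ≤ c ∧ c ⬝ᵥ w = y' ⬝ᵥ (M *ᵥ w) ∧
      ‖WithLp.toLp 2 y'‖ ≤ lipBound M c := by
  classical
  have hcs : ∀ j, w j ≠ 0 → (y ᵥ* M) j = c j := by
    rw [Matrix.dotProduct_mulVec, ← sub_eq_zero, ← sub_dotProduct, dotProduct,
      Finset.sum_eq_zero_iff_of_nonneg
        fun j _ => mul_nonneg (show 0 ≤ (c - y ᵥ* M) j from sub_nonneg.2 (hy j)) (hw j)] at hopt
    intro j hj
    have := (mul_eq_zero.1 (hopt j (Finset.mem_univ j))).resolve_right hj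
    simp only [Pi.sub_apply] at this
    linarith
  obtain ⟨y₁, hy₁, hcs₁, hspan⟩ := exists_dual_span_tight M c w y hy hcs
  obtain ⟨k, r, s, hB, hsT, hs⟩ := exists_isUnit_submatrix_span M {i | (y₁ ᵥ* M) i = c i}
  obtain ⟨y', hy's, hnorm⟩ := exists_basic_dual M c r s hB
  -- `y'` and `y₁` agree on the columns `s`, hence on all columns
  have heq : y' ᵥ* M = y₁ ᵥ* M := by
    ext j
    have hj : Mᵀ j ∈ Submodule.span ℝ (Set.range (fun i => Mᵀ (s i))) := hs ▸ hspan j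
    change y' ⬝ᵥ Mᵀ j = y₁ ⬝ᵥ Mᵀ j
    generalize Mᵀ j = v at hj
    induction hj using Submodule.span_induction with
    | mem x hx =>
      obtain ⟨i, rfl⟩ := hx
      exact (hy's i).trans (hsT i).symm
    | zero => simp
    | add a b _ _ ha hb => rw [dotProduct_add, dotProduct_add, ha, hb]
    | smul t a _ ha => rw [dotProduct_smul, dotProduct_smul, ha]
  refine ⟨y', heq ▸ hy₁, ?_, hnorm⟩
  rw [Matrix.dotProduct_mulVec, heq]
  refine Finset.sum_congr rfl fun j _ => ?_
  by_cases hj : w j = 0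
  · simp [hj]
  · rw [hcs₁ j hj]

/-! ### Integer right-hand sides: perturbation and attainment -/

theorem abs_dotProduct_le_norm {p : Type*} [Fintype p] (a b : p → ℝ) :
    |a ⬝ᵥ b| ≤ ‖WithLp.toLp 2 a‖ * ‖WithLp.toLp 2 b‖ := by
  have := abs_real_inner_le_norm (WithLp.toLp 2 b : EuclideanSpace ℝ p) (WithLp.toLp 2 a)
  rwa [EuclideanSpace.inner_toLp_toLp, star_trivial, mul_comm] at this

/-- Finitely many rational affine functions have a common denominator on the integer vectors. -/
theorem exists_common_denominator {n : Type*} [Fintype n] (A : Finset (ℚ × (n → ℚ))) :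
    ∃ D : ℝ, 0 < D ∧ ∀ a ∈ A, ∀ z : n → ℤ, ∃ k : ℤ,
      D * ((a.1 : ℝ) + realVec a.2 ⬝ᵥ fun i => (z i : ℝ)) = k := by
  classical
  obtain ⟨⟨D, hD⟩, h⟩ := IsLocalization.exist_integer_multiples_of_finset (nonZeroDivisors ℤ)
    (A.image Prod.fst ∪ (A ×ˢ (Finset.univ : Finset n)).image (fun x => x.1.2 x.2) : Finset ℚ)
  have hD0 : D ≠ 0 := nonZeroDivisors.ne_zero hD
  have hint : ∀ a ∈ A, ∀ z : n → ℤ, ∃ k : ℤ,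
      (D : ℝ) * ((a.1 : ℝ) + realVec a.2 ⬝ᵥ fun i => (z i : ℝ)) = k := by
    intro a ha z
    obtain ⟨k₀, hk₀⟩ := h a.1 (Finset.mem_union_left _ (Finset.mem_image_of_mem _ ha))
    have h' : ∀ i, ∃ k : ℤ, (k : ℚ) = D * a.2 i := fun i => by
      obtain ⟨k, hk⟩ := h (a.2 i) (Finset.mem_union_right _
        (Finset.mem_image.2 ⟨(a, i), by simp [ha], rfl⟩))
      exact ⟨k, by simpa using hk⟩
    choose k hk using h'
    have hk₀' : (k₀ : ℚ) = D * a.1 := by simpa using hk₀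
    refine ⟨k₀ + ∑ i, k i * z i, ?_⟩
    have hkR : ∀ i, (k i : ℝ) = D * (a.2 i : ℝ) := fun i => by exact_mod_cast hk i
    have hkR₀ : (k₀ : ℝ) = D * (a.1 : ℝ) := by exact_mod_cast hk₀'
    push_cast
    rw [hkR₀, mul_add, dotProduct, Finset.mul_sum]
    congr 1
    refine Finset.sum_congr rfl fun i _ => ?_
    rw [hkR, realVec, mul_assoc]
  refine ⟨|(D : ℝ)|, abs_pos.2 (by exact_mod_cast hD0), fun a ha z => ?_⟩
  obtain ⟨k, hk⟩ := hint a ha z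
  rcases abs_choice (D : ℝ) with hs | hs
  · exact ⟨k, by rw [hs, hk]⟩
  · exact ⟨-k, by rw [hs, neg_mul, hk, Int.cast_neg]⟩

theorem realVec_dotProduct_sub_mulVec {p n : Type*} [Fintype p] [Fintype n] (N : Matrix p n ℚ)
    (g h : p → ℚ) (z : n → ℝ) : realVec h ⬝ᵥ (realVec g - realMat N *ᵥ z) =
      ((h ⬝ᵥ g : ℚ) : ℝ) - realVec (h ᵥ* N) ⬝ᵥ z := by
  rw [dotProduct_sub, realVec_dotProduct, Matrix.dotProduct_mulVec]
  congr 2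
  ext i
  simp [realVec, realMat, Matrix.vecMul, dotProduct]

/-- In a standard form program whose right-hand side depends on integer variables `z`, a small
perturbation `u` of the right-hand side does not make any `z` feasible that is infeasible without
it, because the feasibility certificates take values in a lattice. At the feasible `z` the value of
the program changes by at most `β(M) ‖c‖ ‖u‖`. -/
theorem exists_perturbation_bound {p q n : Type*} [Fintype p] [Fintype q] [Fintype n]
    (M : Matrix p q ℚ) (c : q → ℚ) (N : Matrix p n ℚ) (g : p → ℚ) :
    ∃ δ : ℝ, 0 < δ ∧ ∀ (z : n → ℤ) (u : p → ℝ) (w : q → ℝ) (L : ℝ), ‖WithLp.toLp 2 u‖ ≤ δ →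
      0 ≤ w → realMat M *ᵥ w = realVec g - realMat N *ᵥ (fun i => (z i : ℝ)) + u →
      (∀ w' : q → ℝ, 0 ≤ w' → realMat M *ᵥ w' = realVec g - realMat N *ᵥ (fun i => (z i : ℝ)) →
        L ≤ realVec c ⬝ᵥ w') →
      ∃ w₀ : q → ℝ, 0 ≤ w₀ ∧ realMat M *ᵥ w₀ = realVec g - realMat N *ᵥ (fun i => (z i : ℝ)) ∧
        realVec c ⬝ᵥ w₀ ≤ realVec c ⬝ᵥ w +
          lipBound (realMat M) (realVec c) * ‖WithLp.toLp 2 u‖ := by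
  classical
  obtain ⟨F, Y, hF, hY, hopt⟩ := exists_lp_certificates M c
  obtain ⟨D, hD, hint⟩ := exists_common_denominator
    (F.image fun h => (h ⬝ᵥ g, -(h ᵥ* N)))
  set C : ℝ := ∑ h ∈ F, ‖WithLp.toLp 2 (realVec h)‖ with hC
  have hC0 : 0 ≤ C := Finset.sum_nonneg fun _ _ => norm_nonneg _
  refine ⟨1 / (D * (C + 1)), by positivity, fun z u w L hu hw hd hL => ?_⟩
  have hfeas : ∃ w : q → ℝ, 0 ≤ w ∧
      realMat M *ᵥ w = realVec g - realMat N *ᵥ (fun i => (z i : ℝ)) := by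
    refine (hF _).2 fun h hh => ?_
    have h1 := (hF _).1 ⟨w, hw, hd⟩ h hh
    rw [dotProduct_add] at h1
    obtain ⟨k, hk⟩ := hint _ (Finset.mem_image_of_mem _ hh) z
    have hval : (((h ⬝ᵥ g : ℚ) : ℝ) + realVec (-(h ᵥ* N)) ⬝ᵥ fun i => (z i : ℝ)) =
        realVec h ⬝ᵥ (realVec g - realMat N *ᵥ (fun i => (z i : ℝ))) := by
      rw [realVec_dotProduct_sub_mulVec, sub_eq_add_neg, ← neg_dotProduct]
      congr 2
      ext i
      simp [realVec]
    rw [hval] at hk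
    have h2 : realVec h ⬝ᵥ u < 1 / D := by
      have hle : ‖WithLp.toLp 2 (realVec h)‖ ≤ C :=
        Finset.single_le_sum (f := fun h : p → ℚ => ‖WithLp.toLp 2 (realVec h)‖)
          (fun _ _ => norm_nonneg _) hh
      calc realVec h ⬝ᵥ u ≤ ‖WithLp.toLp 2 (realVec h)‖ * ‖WithLp.toLp 2 u‖ :=
            (le_abs_self _).trans (abs_dotProduct_le_norm _ _)
        _ ≤ C * (1 / (D * (C + 1))) := mul_le_mul hle hu (norm_nonneg _) hC0
        _ < 1 / D := by
          rw [mul_one_div, div_lt_div_iff₀ (by positivity) hD]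
          nlinarith
    -- the certificate is a multiple of `1 / D` and larger than `-1 / D`
    have h3 : (-1 : ℝ) < k := by
      rw [← hk]
      have h4 := mul_lt_mul_of_pos_left h2 hD
      rw [mul_one_div_cancel hD.ne'] at h4
      nlinarith [mul_nonneg hD.le h1]
    have h5 : (0 : ℤ) ≤ k := by
      have : (-1 : ℤ) < k := by exact_mod_cast h3
      omega
    have h6 : (0 : ℝ) ≤ D * realVec h ⬝ᵥ (realVec g - realMat N *ᵥ (fun i => (z i : ℝ))) := by
      rw [hk]
      exact_mod_cast h5
    exact nonneg_of_mul_nonneg_right h6 hD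
  obtain ⟨w₀, hw₀, hd₀, y, hy, hval⟩ := hopt _ L hfeas hL
  obtain ⟨y', hy', hval', hnorm⟩ := exists_dual_norm_le (realMat M) (realVec c) w₀ (realVec y) hw₀
    (hY y hy) (by rw [hval, hd₀])
  refine ⟨w₀, hw₀, hd₀, ?_⟩
  have hweak : y' ⬝ᵥ (realMat M *ᵥ w) ≤ realVec c ⬝ᵥ w := by
    rw [Matrix.dotProduct_mulVec]
    exact dotProduct_le_dotProduct_of_nonneg_right hy' hw
  rw [hd, dotProduct_add] at hweak
  rw [hval', hd₀]
  have h1 := neg_le_of_abs_le (abs_dotProduct_le_norm y' u)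
  have h2 := mul_le_mul_of_nonneg_right hnorm (norm_nonneg (WithLp.toLp 2 u))
  linarith

/-- A feasible rational mixed-integer program in standard form that is bounded below attains its
minimum: for fixed integer variables the optimal values lie in a lattice. -/
theorem exists_mixedInteger_minimum {p q n : Type*} [Fintype p] [Fintype q] [Fintype n]
    (M : Matrix p q ℚ) (c : q → ℚ) (N : Matrix p n ℚ) (g : p → ℚ) (e : n → ℚ) (L : ℝ)
    (hfeas : ∃ (z : n → ℤ) (w : q → ℝ), 0 ≤ w ∧
      realMat M *ᵥ w = realVec g - realMat N *ᵥ (fun i => (z i : ℝ)))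
    (hL : ∀ (z : n → ℤ) (w : q → ℝ), 0 ≤ w →
      realMat M *ᵥ w = realVec g - realMat N *ᵥ (fun i => (z i : ℝ)) →
      L ≤ realVec e ⬝ᵥ (fun i => (z i : ℝ)) + realVec c ⬝ᵥ w) :
    ∃ (z : n → ℤ) (w : q → ℝ), 0 ≤ w ∧
      realMat M *ᵥ w = realVec g - realMat N *ᵥ (fun i => (z i : ℝ)) ∧
      ∀ (z' : n → ℤ) (w' : q → ℝ), 0 ≤ w' →
        realMat M *ᵥ w' = realVec g - realMat N *ᵥ (fun i => (z' i : ℝ)) →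
        realVec e ⬝ᵥ (fun i => (z i : ℝ)) + realVec c ⬝ᵥ w ≤
          realVec e ⬝ᵥ (fun i => (z' i : ℝ)) + realVec c ⬝ᵥ w' := by
  classical
  obtain ⟨F, Y, -, hY, hopt⟩ := exists_lp_certificates M c
  obtain ⟨D, hD, hint⟩ := exists_common_denominator
    (Y.image fun y => (y ⬝ᵥ g, e - y ᵥ* N))
  have hbest : ∀ (z : n → ℤ) (w : q → ℝ), 0 ≤ w →
      realMat M *ᵥ w = realVec g - realMat N *ᵥ (fun i => (z i : ℝ)) →
      ∃ (k : ℤ) (w₀ : q → ℝ), 0 ≤ w₀ ∧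
        realMat M *ᵥ w₀ = realVec g - realMat N *ᵥ (fun i => (z i : ℝ)) ∧
        D * (realVec e ⬝ᵥ (fun i => (z i : ℝ)) + realVec c ⬝ᵥ w₀) = k ∧
        realVec c ⬝ᵥ w₀ ≤ realVec c ⬝ᵥ w := by
    intro z w hw hd
    obtain ⟨w₀, hw₀, hd₀, y, hy, hval⟩ := hopt _ (L - realVec e ⬝ᵥ (fun i => (z i : ℝ)))
      ⟨w, hw, hd⟩ fun w' hw' hd' => by linarith [hL z w' hw' hd']
    obtain ⟨k, hk⟩ := hint _ (Finset.mem_image_of_mem _ hy) z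
    refine ⟨k, w₀, hw₀, hd₀, ?_, ?_⟩
    · rw [← hk, hval, realVec_dotProduct_sub_mulVec, realVec_sub, sub_dotProduct]
      ring
    · rw [hval, ← hd, Matrix.dotProduct_mulVec]
      exact dotProduct_le_dotProduct_of_nonneg_right (hY y hy) hw
  obtain ⟨k, ⟨z, w, hw, hd, hk⟩, hmin⟩ := Int.exists_least_of_bdd
    (P := fun k : ℤ => ∃ (z : n → ℤ) (w : q → ℝ), 0 ≤ w ∧
        realMat M *ᵥ w = realVec g - realMat N *ᵥ (fun i => (z i : ℝ)) ∧
        D * (realVec e ⬝ᵥ (fun i => (z i : ℝ)) + realVec c ⬝ᵥ w) = k)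
    ⟨⌊D * L⌋, by
      rintro k ⟨z, w, hw, hd, hk⟩
      have h1 := mul_le_mul_of_nonneg_left (hL z w hw hd) hD.le
      rw [hk] at h1
      exact_mod_cast (Int.floor_le _).trans h1⟩
    (by
      obtain ⟨z, w, hw, hd⟩ := hfeas
      obtain ⟨k, w₀, hw₀, hd₀, hk, -⟩ := hbest z w hw hd
      exact ⟨k, z, w₀, hw₀, hd₀, hk⟩)
  refine ⟨z, w, hw, hd, fun z' w' hw' hd' => ?_⟩
  obtain ⟨k', w₀, hw₀, hd₀, hk', hle⟩ := hbest z' w' hw' hd'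
  have h1 : (k : ℝ) ≤ k' := by exact_mod_cast hmin k' ⟨z', w₀, hw₀, hd₀, hk'⟩
  rw [← hk, ← hk'] at h1
  linarith [le_of_mul_le_mul_left h1 hD]

/-! ### The equality form, local bound and attained minimum of the program -/

/-- The equality form of the system `A x = a`, `E x ≤ e` with free variables `x`: the columns are
those of `x⁺`, of `x⁻` and of the slack variables. -/
def equalityForm {p r n : Type*} [DecidableEq r] (A : Matrix p n ℚ) (E : Matrix r n ℚ) :
    Matrix (p ⊕ r) ((n ⊕ n) ⊕ r) ℚ :=
  Matrix.fromBlocks (Matrix.fromCols A (-A)) 0 (Matrix.fromCols E (-E)) 1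

/-- The costs `(c, -c, 0)` of the equality form. -/
def equalityCost {n : Type*} (r : Type*) (c : n → ℚ) : (n ⊕ n) ⊕ r → ℚ :=
  Sum.elim (Sum.elim c (-c)) 0

/-- The vector `x = x⁺ - x⁻` that is represented by a point of the equality form. -/
def freePart {n r : Type*} (w : (n ⊕ n) ⊕ r → ℝ) : n → ℝ :=
  fun j => w (Sum.inl (Sum.inl j)) - w (Sum.inl (Sum.inr j))

theorem equalityCost_dotProduct {r n : Type*} [Fintype n] [Fintype r] (c : n → ℚ)
    (w : (n ⊕ n) ⊕ r → ℝ) :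
    realVec (equalityCost r c) ⬝ᵥ w = realVec c ⬝ᵥ freePart w := by
  simp [dotProduct, realVec, equalityCost, freePart, mul_add, Finset.sum_add_distrib,
    sub_eq_add_neg]

section EqualityForm

variable {p r n : Type*} [Fintype n] [Fintype r] [DecidableEq r]
  (A : Matrix p n ℚ) (E : Matrix r n ℚ)

theorem equalityForm_mulVec (w : (n ⊕ n) ⊕ r → ℝ) :
    realMat (equalityForm A E) *ᵥ w =
      Sum.elim (realMat A *ᵥ freePart w) (realMat E *ᵥ freePart w + fun i => w (Sum.inr i)) := by
  ext (i | i)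
  · simp [Matrix.mulVec, dotProduct, realMat, equalityForm, freePart, mul_add,
      Finset.sum_add_distrib, sub_eq_add_neg]
  · simp [Matrix.mulVec, dotProduct, realMat, equalityForm, freePart, mul_add,
      Finset.sum_add_distrib, sub_eq_add_neg, Matrix.one_apply, apply_ite (Rat.cast : ℚ → ℝ)]

theorem exists_equalityForm_of_le {a : p → ℝ} {e : r → ℝ} {x : n → ℝ} (ha : realMat A *ᵥ x = a)
    (he : realMat E *ᵥ x ≤ e) : ∃ w : (n ⊕ n) ⊕ r → ℝ, 0 ≤ w ∧
      realMat (equalityForm A E) *ᵥ w = Sum.elim a e ∧ freePart w = x := by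
  have hx : freePart (Sum.elim (Sum.elim x⁺ x⁻) (e - realMat E *ᵥ x)) = x := by
    ext j
    exact congrFun (posPart_sub_negPart x) j
  refine ⟨Sum.elim (Sum.elim x⁺ x⁻) (e - realMat E *ᵥ x), ?_, ?_, hx⟩
  · rintro ((j | j) | i)
    · exact posPart_nonneg x j
    · exact negPart_nonneg x j
    · exact sub_nonneg.2 (he i)
  · rw [equalityForm_mulVec, hx, ha]
    congr 1
    ext i
    simp

theorem freePart_of_equalityForm {a : p → ℝ} {e : r → ℝ} {w : (n ⊕ n) ⊕ r → ℝ} (hw : 0 ≤ w)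
    (h : realMat (equalityForm A E) *ᵥ w = Sum.elim a e) :
    realMat A *ᵥ freePart w = a ∧ realMat E *ᵥ freePart w ≤ e := by
  rw [equalityForm_mulVec] at h
  refine ⟨funext fun i => congrFun h (Sum.inl i), fun i => ?_⟩
  have h1 := congrFun h (Sum.inr i)
  have h2 : 0 ≤ w (Sum.inr i) := hw _
  simp only [Sum.elim_inr, Pi.add_apply] at h1
  linarith

end EqualityForm

namespace MILP

variable {m l n₁ n₂ : ℕ} (P : MILP m l n₁ n₂)

theorem stdMatrix_eq : P.stdMatrix = realMat (equalityForm P.A_C P.E_C) := by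
  ext (i | i) ((j | j) | j) <;>
    simp [stdMatrix, equalityForm, realMat, Matrix.one_apply]
  split_ifs <;> simp

theorem stdCost_eq : P.stdCost = realVec (equalityCost (Fin l) P.c_C) := by
  ext ((j | j) | j) <;> simp [stdCost, equalityCost, realVec]

theorem mem_H_iff {u : EuclideanSpace ℝ (Fin m)} {x : (Fin n₁ → ℝ) × (Fin n₂ → ℝ)} :
    x ∈ P.H u ↔ realMat P.A_I *ᵥ x.1 + realMat P.A_C *ᵥ x.2 = realVec P.b + u.ofLp :=
  ⟨fun h => funext h, fun h => congrFun h⟩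

theorem mem_X_iff {x : (Fin n₁ → ℝ) × (Fin n₂ → ℝ)} :
    x ∈ P.X ↔ x ∈ P.XR ∧ ∃ z : Fin n₁ → ℤ, x.1 = fun i => (z i : ℝ) := by
  refine and_congr_right fun _ => ⟨fun h => ?_, ?_⟩
  · choose z hz using h
    exact ⟨z, funext hz⟩
  · rintro ⟨z, hz⟩ i
    exact ⟨z i, congrFun hz i⟩

theorem mem_H_neg_residual (x : (Fin n₁ → ℝ) × (Fin n₂ → ℝ)) : x ∈ P.H (-P.residual x) := by
  rw [mem_H_iff]
  simp [residual]

theorem residual_eq_zero {x : (Fin n₁ → ℝ) × (Fin n₂ → ℝ)} (hx : x ∈ P.H 0) :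
    P.residual x = 0 := by
  rw [mem_H_iff] at hx
  rw [residual, hx]
  simp

theorem value_eq_of_isLeast {z : ℝ} {u : EuclideanSpace ℝ (Fin m)}
    (h : IsLeast (P.obj '' (P.X ∩ P.H u)) z) : P.value u = z := by
  obtain ⟨⟨x, hx, rfl⟩, hmin⟩ := h
  refine le_antisymm (iInf₂_le x hx) (le_iInf₂ fun y hy => ?_)
  exact_mod_cast hmin (Set.mem_image_of_mem _ hy)

theorem localBound_of_forall_exists {κ δ : ℝ}
    (h : ∀ u : EuclideanSpace ℝ (Fin m), ‖u‖ ≤ δ → ∀ x ∈ P.X ∩ P.H u,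
      ∃ x₀ ∈ P.X ∩ P.H 0, P.obj x₀ ≤ P.obj x + κ * ‖u‖) : P.LocalBound κ δ := by
  intro u hu
  rw [← EReal.sub_le_iff_le_add (Or.inl (EReal.coe_ne_bot _)) (Or.inl (EReal.coe_ne_top _))]
  refine le_iInf₂ fun x hx => ?_
  rw [EReal.sub_le_iff_le_add (Or.inl (EReal.coe_ne_bot _)) (Or.inl (EReal.coe_ne_top _))]
  obtain ⟨x₀, hx₀, hle⟩ := h u hu x hx
  refine (iInf₂_le x₀ hx₀).trans ?_
  exact_mod_cast hle

/-- The right-hand side of the equality form, for fixed integer variables `z`. -/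
theorem rhs_eq (z : Fin n₁ → ℝ) :
    realVec (Sum.elim P.b P.f) - realMat (Matrix.fromRows P.A_I P.E_I) *ᵥ z =
      Sum.elim (realVec P.b - realMat P.A_I *ᵥ z) (realVec P.f - realMat P.E_I *ᵥ z) := by
  ext (i | i) <;> simp [realVec, realMat, Matrix.mulVec, dotProduct]

/-- A solution of the relaxation with right-hand side `b + u` gives one of the equality form in the
continuous variables; only the penalized rows are perturbed. -/
theorem exists_equalityForm_point {u : EuclideanSpace ℝ (Fin m)} {z : Fin n₁ → ℝ}
    {x : Fin n₂ → ℝ} (hx : (z, x) ∈ P.XR ∩ P.H u) :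
    ∃ w, 0 ≤ w ∧ realMat (equalityForm P.A_C P.E_C) *ᵥ w =
      realVec (Sum.elim P.b P.f) - realMat (Matrix.fromRows P.A_I P.E_I) *ᵥ z +
        Sum.elim u.ofLp 0 ∧
      realVec (equalityCost (Fin l) P.c_C) ⬝ᵥ w = realVec P.c_C ⬝ᵥ x := by
  obtain ⟨hE, hA⟩ := hx
  rw [mem_H_iff] at hA
  obtain ⟨w, hw, hd, rfl⟩ := exists_equalityForm_of_le P.A_C P.E_C
    (a := realVec P.b - realMat P.A_I *ᵥ z + u.ofLp) (e := realVec P.f - realMat P.E_I *ᵥ z)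
    (x := x) (by rw [eq_sub_of_add_eq' hA]; abel) (le_sub_iff_add_le'.2 hE)
  refine ⟨w, hw, ?_, equalityCost_dotProduct _ _⟩
  rw [hd, rhs_eq]
  ext (i | i) <;> simp

theorem mem_of_equalityForm {z : Fin n₁ → ℝ} {w : (Fin n₂ ⊕ Fin n₂) ⊕ Fin l → ℝ} (hw : 0 ≤ w)
    (hd : realMat (equalityForm P.A_C P.E_C) *ᵥ w =
      realVec (Sum.elim P.b P.f) - realMat (Matrix.fromRows P.A_I P.E_I) *ᵥ z) :
    (z, freePart w) ∈ P.XR ∩ P.H 0 := by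
  rw [rhs_eq] at hd
  obtain ⟨hA, hE⟩ := freePart_of_equalityForm _ _ hw hd
  refine ⟨le_sub_iff_add_le'.1 hE, ?_⟩
  rw [mem_H_iff, hA]
  simp

theorem norm_sumElim_zero (u : EuclideanSpace ℝ (Fin m)) :
    ‖WithLp.toLp 2 (Sum.elim u.ofLp (0 : Fin l → ℝ))‖ = ‖u‖ := by
  simp [EuclideanSpace.norm_eq]

theorem exists_localBound (hbdd : BddBelow (P.obj '' (P.XR ∩ P.H 0))) :
    ∃ δ : ℝ, 0 < δ ∧ P.LocalBound (lipBound P.stdMatrix P.stdCost) δ := by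
  obtain ⟨L, hL⟩ := hbdd
  obtain ⟨δ, hδ, h⟩ := exists_perturbation_bound (equalityForm P.A_C P.E_C)
    (equalityCost (Fin l) P.c_C) (Matrix.fromRows P.A_I P.E_I) (Sum.elim P.b P.f)
  refine ⟨δ, hδ, P.localBound_of_forall_exists ?_⟩
  rintro u hu ⟨x₁, x₂⟩ ⟨hX, hH⟩
  obtain ⟨hXR, z, hz⟩ := P.mem_X_iff.1 hX
  obtain rfl : x₁ = fun i => (z i : ℝ) := hz
  obtain ⟨w, hw, hd, hc⟩ := P.exists_equalityForm_point ⟨hXR, hH⟩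
  obtain ⟨w₀, hw₀, hd₀, hle⟩ := h z (Sum.elim u.ofLp 0) w
    (L - realVec P.c_I ⬝ᵥ fun i => (z i : ℝ)) (by rwa [norm_sumElim_zero]) hw hd fun w' hw' hd' => by
      have := hL (Set.mem_image_of_mem _ (P.mem_of_equalityForm hw' hd'))
      rw [equalityCost_dotProduct]
      simp only [obj] at this
      linarith
  have hmem := P.mem_of_equalityForm hw₀ hd₀
  refine ⟨_, ⟨P.mem_X_iff.2 ⟨hmem.1, z, rfl⟩, hmem.2⟩, ?_⟩
  rw [norm_sumElim_zero, hc, equalityCost_dotProduct, ← stdMatrix_eq, ← stdCost_eq] at hle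
  simp only [obj]
  linarith

/-- For programs in nonnegative variables `A_C x_C = b - A_I x_I + u`, `x_C ≥ 0` is already in standard
form, with `x_I ≥ 0` a condition on the integer vector only. -/
theorem exists_localBound_of_isNonnegForm (hbdd : BddBelow (P.obj '' (P.XR ∩ P.H 0)))
    (hP : P.IsNonnegForm) :
    ∃ δ : ℝ, 0 < δ ∧ P.LocalBound (lipBound (realMat P.A_C) (realVec P.c_C)) δ := by
  obtain ⟨L, hL⟩ := hbdd
  obtain ⟨δ, hδ, h⟩ := exists_perturbation_bound P.A_C P.c_C P.A_I P.b
  refine ⟨δ, hδ, P.localBound_of_forall_exists ?_⟩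
  rintro u hu ⟨x₁, x₂⟩ ⟨hX, hH⟩
  obtain ⟨hXR, z, hz⟩ := P.mem_X_iff.1 hX
  obtain rfl : x₁ = fun i => (z i : ℝ) := hz
  have hP' : ∀ x, x ∈ P.XR ↔ 0 ≤ x.1 ∧ 0 ≤ x.2 := fun x => by
    rw [show P.XR = _ from hP]
    rfl
  obtain ⟨hz, hx₂⟩ := (hP' _).1 hXR
  have hmem : ∀ w : Fin n₂ → ℝ, 0 ≤ w →
      realMat P.A_C *ᵥ w = realVec P.b - realMat P.A_I *ᵥ (fun i => (z i : ℝ)) →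
      ((fun i => (z i : ℝ)), w) ∈ P.XR ∩ P.H 0 := fun w hw hd => by
    refine ⟨(hP' _).2 ⟨hz, hw⟩, ?_⟩
    rw [mem_H_iff, hd]
    simp
  obtain ⟨w₀, hw₀, hd₀, hle⟩ := h z u.ofLp x₂
    (L - realVec P.c_I ⬝ᵥ fun i => (z i : ℝ)) hu hx₂
    (by rw [eq_sub_of_add_eq' (P.mem_H_iff.1 hH)]; abel) fun w' hw' hd' => by
      have := hL (Set.mem_image_of_mem _ (hmem w' hw' hd'))
      simp only [obj] at this
      linarith
  have hm := hmem w₀ hw₀ hd₀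
  refine ⟨_, ⟨P.mem_X_iff.2 ⟨hm.1, z, rfl⟩, hm.2⟩, ?_⟩
  simp only [obj]
  change _ ≤ _ + _ * ‖u‖ at hle
  linarith

theorem exists_isLeast_obj (hfeas : (P.X ∩ P.H 0).Nonempty)
    (hbdd : BddBelow (P.obj '' (P.XR ∩ P.H 0))) :
    ∃ zIP : ℝ, IsLeast (P.obj '' (P.X ∩ P.H 0)) zIP := by
  obtain ⟨L, hL⟩ := hbdd
  have hpoint : ∀ x ∈ P.X ∩ P.H 0, ∃ (z : Fin n₁ → ℤ) (w : (Fin n₂ ⊕ Fin n₂) ⊕ Fin l → ℝ), 0 ≤ w ∧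
      realMat (equalityForm P.A_C P.E_C) *ᵥ w = realVec (Sum.elim P.b P.f) -
        realMat (Matrix.fromRows P.A_I P.E_I) *ᵥ (fun i => (z i : ℝ)) ∧
      P.obj x = realVec P.c_I ⬝ᵥ (fun i => (z i : ℝ)) +
        realVec (equalityCost (Fin l) P.c_C) ⬝ᵥ w := by
    rintro ⟨x₁, x₂⟩ ⟨hX, hH⟩
    obtain ⟨hXR, z, hz⟩ := P.mem_X_iff.1 hX
    obtain rfl : x₁ = fun i => (z i : ℝ) := hz
    obtain ⟨w, hw, hd, hc⟩ := P.exists_equalityForm_point ⟨hXR, hH⟩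
    refine ⟨z, w, hw, ?_, by rw [hc, obj]⟩
    rw [hd]
    ext (i | i) <;> simp
  have hobj : ∀ (z : Fin n₁ → ℝ) (w : (Fin n₂ ⊕ Fin n₂) ⊕ Fin l → ℝ),
      P.obj (z, freePart w) =
        realVec P.c_I ⬝ᵥ z + realVec (equalityCost (Fin l) P.c_C) ⬝ᵥ w := fun z w => by
    rw [equalityCost_dotProduct, obj]
  obtain ⟨z, w, hw, hd, hmin⟩ := exists_mixedInteger_minimum (equalityForm P.A_C P.E_C)
    (equalityCost (Fin l) P.c_C) (Matrix.fromRows P.A_I P.E_I) (Sum.elim P.b P.f) P.c_I L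
    (by
      obtain ⟨x, hx⟩ := hfeas
      obtain ⟨z, w, hw, hd, -⟩ := hpoint x hx
      exact ⟨z, w, hw, hd⟩)
    (fun z w hw hd => by
      rw [← hobj]
      exact hL (Set.mem_image_of_mem _ (P.mem_of_equalityForm hw hd)))
  have hm := P.mem_of_equalityForm hw hd
  refine ⟨_, Set.mem_image_of_mem _ ⟨P.mem_X_iff.2 ⟨hm.1, z, rfl⟩, hm.2⟩, ?_⟩
  rintro _ ⟨x, hx, rfl⟩
  obtain ⟨z', w', hw', hd', hc'⟩ := hpoint x hx
  rw [hobj, hc']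
  exact hmin z' w' hw' hd'

end MILP

/-! ### Karush-Kuhn-Tucker points and exact penalties -/

namespace MILP

variable {m l n₁ n₂ : ℕ} (P : MILP m l n₁ n₂)

/-- Linear programming duality for the continuous relaxation: the multipliers are read off from an
optimal dual vector of its equality form. -/
theorem exists_isKKT (hfeas : (P.XR ∩ P.H 0).Nonempty)
    (hbdd : BddBelow (P.obj '' (P.XR ∩ P.H 0))) : ∃ x lamA lamE, P.IsKKT x lamA lamE := by
  obtain ⟨L, hL⟩ := hbdd
  set A := Matrix.fromCols P.A_I P.A_C with hA
  set E := Matrix.fromCols P.E_I P.E_C with hE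
  set c := Sum.elim P.c_I P.c_C with hc
  have hAx : ∀ x : Fin n₁ ⊕ Fin n₂ → ℝ, realMat A *ᵥ x =
      realMat P.A_I *ᵥ (fun i => x (Sum.inl i)) + realMat P.A_C *ᵥ (fun i => x (Sum.inr i)) := by
    intro x
    ext i
    simp [hA, realMat, Matrix.mulVec, dotProduct]
  have hEx : ∀ x : Fin n₁ ⊕ Fin n₂ → ℝ, realMat E *ᵥ x =
      realMat P.E_I *ᵥ (fun i => x (Sum.inl i)) + realMat P.E_C *ᵥ (fun i => x (Sum.inr i)) := by
    intro x
    ext i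
    simp [hE, realMat, Matrix.mulVec, dotProduct]
  have hcx : ∀ x : Fin n₁ ⊕ Fin n₂ → ℝ, realVec c ⬝ᵥ x =
      P.obj (fun i => x (Sum.inl i), fun i => x (Sum.inr i)) := by
    intro x
    simp [hc, obj, realVec, dotProduct]
  have hrhs : realVec (Sum.elim P.b P.f) = Sum.elim (realVec P.b) (realVec P.f) := by
    ext (i | i) <;> rfl
  have hmem : ∀ w, 0 ≤ w → realMat (equalityForm A E) *ᵥ w = realVec (Sum.elim P.b P.f) →
      ((fun i => freePart w (Sum.inl i)), fun i => freePart w (Sum.inr i)) ∈ P.XR ∩ P.H 0 := by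
    intro w hw hd
    rw [hrhs] at hd
    obtain ⟨h1, h2⟩ := freePart_of_equalityForm _ _ hw hd
    rw [hAx] at h1
    rw [hEx] at h2
    refine ⟨h2, ?_⟩
    rw [mem_H_iff, h1]
    simp
  obtain ⟨F, Y, -, hY, hopt⟩ := exists_lp_certificates (equalityForm A E)
    (equalityCost (Fin l) c)
  obtain ⟨w, hw, hd, y, hy, hval⟩ := hopt (realVec (Sum.elim P.b P.f)) L
    (by
      obtain ⟨x, hxE, hxA⟩ := hfeas
      obtain ⟨w, hw, hd, -⟩ := exists_equalityForm_of_le A E (a := realVec P.b) (e := realVec P.f)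
        (x := Sum.elim x.1 x.2)
        (by rw [hAx]; simpa using P.mem_H_iff.1 hxA) (by rw [hEx]; exact hxE)
      exact ⟨w, hw, by rw [hd, hrhs]⟩)
    (fun w hw hd => by
      rw [equalityCost_dotProduct, hcx]
      exact hL (Set.mem_image_of_mem _ (hmem w hw hd)))
  set y₁ : Fin m → ℝ := fun i => y (Sum.inl i) with hy₁
  set y₂ : Fin l → ℝ := fun i => y (Sum.inr i) with hy₂
  have hstat : ∀ j, (y₁ ᵥ* realMat A) j + (y₂ ᵥ* realMat E) j = realVec c j := by
    intro j
    have h1 := hY y hy (Sum.inl (Sum.inl j))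
    have h2 := hY y hy (Sum.inl (Sum.inr j))
    simp [Matrix.vecMul, dotProduct, realVec, realMat, equalityForm, equalityCost] at h1 h2
    simp only [Matrix.vecMul, dotProduct, realVec, realMat, hy₁, hy₂, Matrix.map_apply]
    linarith
  have hneg : ∀ i, y₂ i ≤ 0 := by
    intro i
    have h1 := hY y hy (Sum.inr i)
    simp [Matrix.vecMul, dotProduct, realVec, realMat, equalityForm, equalityCost,
      Matrix.one_apply, apply_ite (Rat.cast : ℚ → ℝ)] at h1
    exact Rat.cast_nonpos.2 h1
  refine ⟨(fun i => freePart w (Sum.inl i), fun i => freePart w (Sum.inr i)), WithLp.toLp 2 y₁,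
    -y₂, hmem w hw hd, fun i => neg_nonneg.2 (hneg i), ?_, ?_, ?_⟩
  · ext j
    have := hstat (Sum.inl j)
    simp only [Matrix.mulVec_transpose, Matrix.neg_vecMul, sub_neg_eq_add, Pi.add_apply]
    exact this.symm
  · ext j
    have := hstat (Sum.inr j)
    simp only [Matrix.mulVec_transpose, Matrix.neg_vecMul, sub_neg_eq_add, Pi.add_apply]
    exact this.symm
  · rw [← hEx]
    have h1 : realVec c ⬝ᵥ freePart w = y₁ ⬝ᵥ realVec P.b + y₂ ⬝ᵥ realVec P.f := by
      rw [← equalityCost_dotProduct (r := Fin l), hval, hrhs]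
      simp [dotProduct, hy₁, hy₂, realVec]
    have h2 : realVec c ⬝ᵥ freePart w =
        y₁ ⬝ᵥ (realMat A *ᵥ freePart w) + y₂ ⬝ᵥ (realMat E *ᵥ freePart w) := by
      rw [Matrix.dotProduct_mulVec, Matrix.dotProduct_mulVec, ← add_dotProduct]
      congr 1
      exact (funext hstat).symm
    rw [hrhs] at hd
    rw [(freePart_of_equalityForm _ _ hw hd).1] at h2
    rw [neg_dotProduct, dotProduct_sub]
    linarith

variable {P}

/-- A Karush-Kuhn-Tucker point gives an affine lower bound on the value function of the continuous
relaxation; at `u = 0` it says that the point is optimal. -/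
theorem IsKKT.obj_add_inner_le {x : (Fin n₁ → ℝ) × (Fin n₂ → ℝ)}
    {lamA : EuclideanSpace ℝ (Fin m)} {lamE : Fin l → ℝ} (h : P.IsKKT x lamA lamE)
    {u : EuclideanSpace ℝ (Fin m)} {y : (Fin n₁ → ℝ) × (Fin n₂ → ℝ)} (hy : y ∈ P.XR ∩ P.H u) :
    P.obj x + inner ℝ u lamA ≤ P.obj y := by
  have hobj : ∀ v : (Fin n₁ → ℝ) × (Fin n₂ → ℝ), P.obj v =
      lamA.ofLp ⬝ᵥ (realMat P.A_I *ᵥ v.1 + realMat P.A_C *ᵥ v.2) -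
        lamE ⬝ᵥ (realMat P.E_I *ᵥ v.1 + realMat P.E_C *ᵥ v.2) := by
    intro v
    rw [obj, h.stationary_I, h.stationary_C]
    simp only [Matrix.mulVec_transpose, sub_dotProduct, dotProduct_add, Matrix.dotProduct_mulVec]
    ring
  have h1 := P.mem_H_iff.1 h.feasible.2
  have h2 := P.mem_H_iff.1 hy.2
  have h3 := h.complementary
  have h4 : lamE ⬝ᵥ (realMat P.E_I *ᵥ y.1 + realMat P.E_C *ᵥ y.2) ≤ lamE ⬝ᵥ realVec P.f :=
    dotProduct_le_dotProduct_of_nonneg_left hy.1 h.nonneg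
  have h5 : inner ℝ u lamA = lamA.ofLp ⬝ᵥ u.ofLp := by
    rw [EuclideanSpace.inner_eq_star_dotProduct, star_trivial]
  rw [hobj x, hobj y, h1, h2, h5, dotProduct_add lamA.ofLp, dotProduct_add lamA.ofLp]
  rw [dotProduct_sub] at h3
  simp only [WithLp.ofLp_zero, dotProduct_zero, add_zero]
  linarith

/-- The penalized objective is at least `zIP`: near the affine subspace `A x = b` by the local
bound, and far from it because the penalty exceeds the gap to the continuous relaxation. -/
theorem IsKKT.le_obj_add_penalty {x : (Fin n₁ → ℝ) × (Fin n₂ → ℝ)}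
    {lamA : EuclideanSpace ℝ (Fin m)} {lamE : Fin l → ℝ} (h : P.IsKKT x lamA lamE) {zIP zR : ℝ}
    (hIP : IsLeast (P.obj '' (P.X ∩ P.H 0)) zIP) (hR : IsLeast (P.obj '' (P.XR ∩ P.H 0)) zR)
    {κ δ ρ : ℝ} (hδ : 0 < δ) (hloc : P.LocalBound κ δ)
    (hρ : max κ (‖lamA‖ + (zIP - zR) / δ) < ρ) {y : (Fin n₁ → ℝ) × (Fin n₂ → ℝ)}
    (hy : y ∈ P.X) : zIP ≤ P.obj y + ρ * ‖P.residual y‖ := by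
  obtain ⟨hκ, hlam⟩ := max_lt_iff.1 hρ
  have hyH := P.mem_H_neg_residual y
  rw [← norm_neg]
  set u := -P.residual y
  rcases le_or_gt ‖u‖ δ with hu | hu
  · have h1 := hloc u hu
    rw [P.value_eq_of_isLeast hIP] at h1
    have h2 : P.value u ≤ P.obj y := iInf₂_le y ⟨hy, hyH⟩
    have h3 : (zIP : EReal) ≤ P.obj y + ((κ * ‖u‖ : ℝ) : EReal) :=
      h1.trans (add_le_add_left h2 _)
    have h4 : zIP ≤ P.obj y + κ * ‖u‖ := by exact_mod_cast h3
    nlinarith [norm_nonneg u]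
  · have h1 := h.obj_add_inner_le ⟨hy.1, hyH⟩
    have h2 : zR ≤ P.obj x := hR.2 (Set.mem_image_of_mem _ h.feasible)
    have h3 := neg_le_of_abs_le (abs_real_inner_le_norm u lamA)
    have hgap : zR ≤ zIP := by
      obtain ⟨v, hv, hv'⟩ := hIP.1
      rw [← hv']
      exact hR.2 (Set.mem_image_of_mem _ ⟨hv.1.1, hv.2⟩)
    have h4 : zIP - zR ≤ (zIP - zR) / δ * ‖u‖ := by
      rw [div_mul_eq_mul_div, le_div_iff₀ hδ]
      exact mul_le_mul_of_nonneg_left hu.le (sub_nonneg.2 hgap)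
    nlinarith [norm_nonneg u]

/-- If the penalized objective is at least `zIP` on `X`, then the augmented Lagrangian dual is
exact, with the multiplier `0`. -/
theorem augDual_eq_and_augRelax_eq {ψ : EuclideanSpace ℝ (Fin m) → ℝ} (hψ : ψ 0 = 0) {ρ zIP : ℝ}
    (hIP : IsLeast (P.obj '' (P.X ∩ P.H 0)) zIP)
    (h : ∀ y ∈ P.X, zIP ≤ P.obj y + ρ * ψ (P.residual y)) :
    P.augDual ψ ρ = P.value 0 ∧ P.augRelax ψ ρ 0 = P.value 0 := by
  rw [P.value_eq_of_isLeast hIP]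
  have hle : ∀ lam, P.augRelax ψ ρ lam ≤ zIP := fun lam => by
    obtain ⟨x, hx, hx'⟩ := hIP.1
    refine (iInf₂_le x hx.1).trans ?_
    rw [P.residual_eq_zero hx.2, hψ, inner_zero_right, mul_zero, add_zero, add_zero, hx']
  have hge : (zIP : EReal) ≤ P.augRelax ψ ρ 0 := le_iInf₂ fun y hy => by
    rw [inner_zero_left, add_zero]
    exact_mod_cast h y hy
  exact ⟨le_antisymm (iSup_le hle) (hge.trans (le_iSup (P.augRelax ψ ρ) 0)),
    le_antisymm (hle 0) hge⟩

end MILP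

/-- On a Euclidean space every norm dominates a positive multiple of the Euclidean norm. -/
theorem Seminorm.exists_pos_mul_norm_le {m : ℕ} (N : Seminorm ℝ (EuclideanSpace ℝ (Fin m)))
    (hN : ∀ u, N u = 0 → u = 0) : ∃ α : ℝ, 0 < α ∧ ∀ u, α * ‖u‖ ≤ N u := by
  have hcont : Continuous N := N.convexOn.locallyLipschitz.continuous
  -- the sphere is empty for `m = 0`
  rcases (Metric.sphere (0 : EuclideanSpace ℝ (Fin m)) 1).eq_empty_or_nonempty with hS | hS
  · refine ⟨1, one_pos, fun u => ?_⟩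
    by_cases hu : u = 0
    · simp [hu]
    · have : ‖u‖⁻¹ • u ∈ Metric.sphere (0 : EuclideanSpace ℝ (Fin m)) 1 := by
        simp [norm_smul, hu]
      simp [hS] at this
  · obtain ⟨v, hv, hmin⟩ := (isCompact_sphere (0 : EuclideanSpace ℝ (Fin m)) 1).exists_isMinOn hS
      hcont.continuousOn
    have hv0 : v ≠ 0 := by
      rintro rfl
      simp at hv
    refine ⟨N v, (apply_nonneg N v).lt_of_ne fun h0 => hv0 (hN v h0.symm), fun u => ?_⟩
    by_cases hu : u = 0
    · simp [hu]
    · have hle : N v ≤ N (‖u‖⁻¹ • u) := hmin (by simp [norm_smul, hu])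
      rw [map_smul_eq_mul, norm_inv, norm_norm, inv_mul_eq_div,
        le_div_iff₀ (norm_pos_iff.2 hu)] at hle
      exact hle

theorem theorem1 {m l n₁ n₂ : ℕ} (P : MILP m l n₁ n₂)
    (hfeas : (P.X ∩ P.H 0).Nonempty)
    (hbdd : BddBelow (P.obj '' (P.XR ∩ P.H 0))) :
    -- every norm on `ℝ^m` gives an exact penalty representation, even with the multiplier `0`
    (∀ N : Seminorm ℝ (EuclideanSpace ℝ (Fin m)), (∀ u, N u = 0 → u = 0) →
      P.HasExactPenalty N ∧
      ∃ ρs : ℝ, 0 < ρs ∧ ∀ ρ : ℝ, ρs < ρ →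
        P.augDual N ρ = P.value 0 ∧ P.augRelax N ρ 0 = P.value 0) ∧
    -- the local Lipschitz bound on the value function, with its explicit constant
    (∃ δ : ℝ, 0 < δ ∧ P.LocalBound (lipBound P.stdMatrix P.stdCost) δ) ∧
    (P.IsNonnegForm →
      ∃ δ : ℝ, 0 < δ ∧ P.LocalBound (lipBound (realMat P.A_C) (realVec P.c_C)) δ) ∧
    -- the finite penalty parameter for the Euclidean norm
    (∃ x lamA lamE, P.IsKKT x lamA lamE) ∧
    ∃ zIP zR : ℝ, IsLeast (P.obj '' (P.X ∩ P.H 0)) zIP ∧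
      IsLeast (P.obj '' (P.XR ∩ P.H 0)) zR ∧
      ∀ (x : (Fin n₁ → ℝ) × (Fin n₂ → ℝ)) (lamA : EuclideanSpace ℝ (Fin m)) (lamE : Fin l → ℝ),
        P.IsKKT x lamA lamE →
        ∀ κ δ : ℝ, 0 ≤ κ → 0 < δ → P.LocalBound κ δ →
          ∀ ρ : ℝ, max κ (‖lamA‖ + (zIP - zR) / δ) < ρ →
            P.augDual (fun u => ‖u‖) ρ = P.value 0 ∧
            P.augRelax (fun u => ‖u‖) ρ 0 = P.value 0 ∧
            IsLeast ((fun y => P.obj y + ρ * ‖P.residual y‖) '' P.X) zIP := by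
  have hsub : P.X ∩ P.H 0 ⊆ P.XR ∩ P.H 0 := fun x hx => ⟨hx.1.1, hx.2⟩
  obtain ⟨x₀, lamA₀, lamE₀, hkkt₀⟩ := P.exists_isKKT (hfeas.mono hsub) hbdd
  obtain ⟨zIP, hIP⟩ := P.exists_isLeast_obj hfeas hbdd
  obtain ⟨δ, hδ, hloc⟩ := P.exists_localBound hbdd
  have hR : IsLeast (P.obj '' (P.XR ∩ P.H 0)) (P.obj x₀) := by
    refine ⟨Set.mem_image_of_mem _ hkkt₀.feasible, ?_⟩
    rintro _ ⟨y, hy, rfl⟩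
    simpa using hkkt₀.obj_add_inner_le hy
  refine ⟨fun N hN => ?_, ⟨δ, hδ, hloc⟩, P.exists_localBound_of_isNonnegForm hbdd,
    ⟨x₀, lamA₀, lamE₀, hkkt₀⟩, zIP, P.obj x₀, hIP, hR, ?_⟩
  · obtain ⟨α, hα, hle⟩ := N.exists_pos_mul_norm_le hN
    -- a penalty parameter that is exact for the Euclidean norm
    obtain ⟨ρ₀, hρ₀, hmax⟩ : ∃ ρ₀ : ℝ, 0 < ρ₀ ∧
        max (lipBound P.stdMatrix P.stdCost) (‖lamA₀‖ + (zIP - P.obj x₀) / δ) < ρ₀ :=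
      ⟨_, (le_max_left 0 _).trans_lt (lt_add_one _), (le_max_right 0 _).trans_lt (lt_add_one _)⟩
    have hexact : ∀ ρ : ℝ, ρ₀ / α < ρ →
        P.augDual N ρ = P.value 0 ∧ P.augRelax N ρ 0 = P.value 0 := by
      intro ρ hρ
      refine MILP.augDual_eq_and_augRelax_eq (map_zero N) hIP fun y hy => ?_
      refine (hkkt₀.le_obj_add_penalty hIP hR hδ hloc hmax hy).trans ?_
      have h1 : ρ₀ ≤ ρ * α := ((div_lt_iff₀ hα).1 hρ).le
      have h2 : 0 < ρ := (div_pos hρ₀ hα).trans hρ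
      have h3 := mul_le_mul_of_nonneg_left (hle (P.residual y)) h2.le
      have h4 := mul_le_mul_of_nonneg_right h1 (norm_nonneg (P.residual y))
      linarith
    have hpos : 0 < ρ₀ / α := div_pos hρ₀ hα
    exact ⟨⟨ρ₀ / α + 1, by linarith, (hexact _ (lt_add_one _)).1⟩, ρ₀ / α, hpos, hexact⟩
  · intro x lamA lamE hkkt κ δ' _ hδ' hloc' ρ hρ
    have hle : ∀ y ∈ P.X, zIP ≤ P.obj y + ρ * ‖P.residual y‖ := fun y hy =>
      hkkt.le_obj_add_penalty hIP hR hδ' hloc' hρ hy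
    obtain ⟨h1, h2⟩ := MILP.augDual_eq_and_augRelax_eq (ψ := fun u => ‖u‖) norm_zero hIP hle
    refine ⟨h1, h2, ?_, ?_⟩
    · obtain ⟨y, hy, hy'⟩ := hIP.1
      exact ⟨y, hy.1, by simp [P.residual_eq_zero hy.2, hy']⟩
    · rintro _ ⟨y, hy, rfl⟩
      exact hle y hy
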